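/- Let $A$ be a bounded linear operator in a real or complex Hilbert space $H$, let $f\in R(A)$, and let $y$ be the minimal-norm solution of $Au=f$. Put $T=A^*A$, $Q=AA^*$, $T_a=T+aI$, $Q_a=Q+aI$. Let $a:[0,\infty)\to(0,\infty)$ be differentiable and monotonically decreasing, with $a(t)\to0$ and $\dot a(t)/a(t)\to0$ as $t\to\infty$. Let $c\in(1,2)$, $u_0\in H$, and let $f_\delta\in H$ be given for $0<\delta<\delta_0$, with $\|f_\delta-f\|\le\delta$, $\|f_\delta\|>c\delta$ and $$\lim_{t\to\infty}e^{t}a(t)\|Q_{a(t)}^{-1}f_\delta\|=\infty .$$ Let $u_\delta(t)$, $t\ge0$, be the solution of $$\dot u_\delta(t)=-u_\delta(t)+T_{a(t)}^{-1}A^*f_\delta,\qquad u_\delta(0)=u_0 ,$$ and consider the discrepancy equation for the unknown $t$ $$\int_0^t e^{-(t-s)}a(s)\|Q_{a(s)}^{-1}f_\delta\|\,ds=c\delta. \qquad(*)$$ Then, for small $\delta$, equation $(*)$ has a unique solution $t_\delta$ away from $t=0$; that is, there is a function $\delta\mapsto t_\delta$ such that, for every $\tau>0$ and all sufficiently small $\delta>0$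 (depending on $\tau$), $t_\delta$ is the one and only solution of $(*)$ in $[\tau,\infty)$. Moreover, $$\lim_{\delta\to0}t_\delta=\infty,\qquad \lim_{\delta\to0}\|u_\delta(t_\delta)-y\|=0 .$$ -/

import Mathlib

open Set Filter Topology

namespace DSM

variable {𝕜 H : Type*} [RCLike 𝕜] [NormedAddCommGroup H] [InnerProductSpace 𝕜 H]
  [CompleteSpace H]

/-- The self-adjoint operator `T = A* A`. -/
noncomputable def opT (A : H →L[𝕜] H) : H →L[𝕜] H := ContinuousLinearMap.adjoint A ∘L A

/-- The self-adjoint operator `Q = A A*`. -/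
noncomputable def opQ (A : H →L[𝕜] H) : H →L[𝕜] H := A ∘L ContinuousLinearMap.adjoint A

/-- The bounded operator `(S + r I)⁻¹`. It is used only for `S = A* A` or `S = A A*` and
`r > 0`, where `S + r I` is invertible. -/
noncomputable def shiftInv (S : H →L[𝕜] H) (r : ℝ) : H →L[𝕜] H :=
  Ring.inverse (S + (r : 𝕜) • (1 : H →L[𝕜] H))

/-- `y` is a solution of `A u = f` of minimal norm. -/
def IsMinimalNormSolution (A : H →L[𝕜] H) (f y : H) : Prop :=
  A y = f ∧ ∀ z : H, A z = f → ‖y‖ ≤ ‖z‖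

/-- `0 < a(t)` on `[0, ∞)`, `a` is differentiable and monotonically decreasing to `0`, and
`a'(t) / a(t) → 0` as `t → ∞`. -/
structure IsRegularizer (a : ℝ → ℝ) : Prop where
  pos : ∀ t, 0 ≤ t → 0 < a t
  differentiableOn : DifferentiableOn ℝ a (Ici 0)
  antitoneOn : AntitoneOn a (Ici 0)
  tendsto_zero : Tendsto a atTop (𝓝 0)
  tendsto_deriv_div : Tendsto (fun t => deriv a t / a t) atTop (𝓝 0)

/-- `u` solves, on `[0, ∞)`, the Cauchy problem
`u'(t) = -u(t) + (T + a(t) I)⁻¹ A* g`, `u(0) = u₀`, where `T = A* A`. -/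
def IsSolution [NormedSpace ℝ H] (A : H →L[𝕜] H) (a : ℝ → ℝ) (g u₀ : H) (u : ℝ → H) : Prop :=
  u 0 = u₀ ∧ ∀ t, 0 ≤ t →
    HasDerivWithinAt u (-u t + shiftInv (opT A) (a t) (ContinuousLinearMap.adjoint A g)) (Ici 0) t

/-- The left-hand side `∫₀ᵗ e^{-(t-s)} a(s) ‖(Q + a(s) I)⁻¹ g‖ ds` of the discrepancy equation,
where `Q = A A*`. -/
noncomputable def discrepancy (A : H →L[𝕜] H) (a : ℝ → ℝ) (g : H) (t : ℝ) : ℝ :=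
  ∫ s in (0 : ℝ)..t, Real.exp (-(t - s)) * (a s * ‖shiftInv (opQ A) (a s) g‖)

end DSM

/-! The left side of (*) is the solution h of h' = -h + g, h(0) = 0, where g(s) = a(s)‖(Q +
a(s))⁻¹f_δ‖ is nonincreasing, because the Tikhonov residual is monotone in its parameter. Once h has
been above a level it therefore crosses that level at most once: at a crossing g must lie below the
level, and it stays there (`damped_unique`).

Existence: replacing f_δ by f = Ay costs at most δ, and the remaining approximation error is o(√a)
since y lies in the closure of R(A*). As cδ > δ, h eventually drops to cδ or lower. At a fixed τ > 0
the left side with f in place of f_δ is positive, so h(τ) > cδ for small δ. Hence the crossing lies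
beyond every prescribed τ, which gives t_δ → ∞.

Convergence: the error is at most e^{-t}‖u₀ - y‖ + δ/(2√a(t)) plus a damped Tikhonov bias that tends
to 0 (`IsSolution.norm_sub_le`). At t = t_δ the discrepancy equation gives (c - 1)δ ≤ o(√a(t_δ)), so
the noise term vanishes as well. Since a'/a → 0, √a decays more slowly than e^{-t/2}, and
exponential averaging preserves o(√a) (`eventually_damped_le`). -/

namespace DSM

/-! ### Resolvent estimates for positive operators and Tikhonov regularization -/

section Operators

open ContinuousLinearMap RCLike

variable {𝕜 H : Type*} [RCLike 𝕜] [NormedAddCommGroup H] [InnerProductSpace 𝕜 H]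

theorem re_inner_smul_self (r : ℝ) (x : H) : re (inner 𝕜 ((r : 𝕜) • x) x) = r * ‖x‖ ^ 2 := by
  rw [inner_smul_left, inner_self_eq_norm_sq_to_K, conj_ofReal]
  norm_cast

theorem re_inner_add_smul_self (S : H →L[𝕜] H) {r : ℝ} {x z : H}
    (hz : S z + (r : 𝕜) • z = x) :
    re (inner 𝕜 (S z) z) + r * ‖z‖ ^ 2 = re (inner 𝕜 x z) := by
  rw [← hz, inner_add_left, map_add, re_inner_smul_self]

variable [CompleteSpace H]

/-- Coercivity: Re⟨(S + r)x, x⟩ ≥ r‖x‖². -/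
theorem isUnit_add_smul_one {S : H →L[𝕜] H} (hS : S.IsPositive) {r : ℝ} (hr : 0 < r) :
    IsUnit (S + (r : 𝕜) • (1 : H →L[𝕜] H)) := by
  refine isUnit_of_forall_le_norm_inner_map _ (c := ⟨r, hr.le⟩) hr fun x => ?_
  refine le_trans ?_ (re_le_norm _)
  have h := hS.re_inner_nonneg_left x
  simp only [add_apply, smul_apply, one_apply_eq_self, inner_add_left, map_add,
    re_inner_smul_self]
  change ‖x‖ ^ 2 * r ≤ _
  linarith

theorem apply_shiftInv_add {S : H →L[𝕜] H} (hS : S.IsPositive) {r : ℝ} (hr : 0 < r) (x : H) :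
    S (shiftInv S r x) + (r : 𝕜) • shiftInv S r x = x := by
  have h := Ring.mul_inverse_cancel _ (isUnit_add_smul_one hS hr)
  simpa using! DFunLike.congr_fun h x

theorem shiftInv_eq {S : H →L[𝕜] H} (hS : S.IsPositive) {r : ℝ} (hr : 0 < r) {x z : H}
    (hz : S z + (r : 𝕜) • z = x) : shiftInv S r x = z := by
  have h := Ring.inverse_mul_cancel _ (isUnit_add_smul_one hS hr)
  have h2 := DFunLike.congr_fun h z
  rw [← hz]
  simpa [shiftInv] using! h2

theorem re_inner_opT (A : H →L[𝕜] H) (z : H) : re (inner 𝕜 (opT A z) z) = ‖A z‖ ^ 2 := by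
  simp [opT, adjoint_inner_left, inner_self_eq_norm_sq_to_K]

theorem mul_norm_shiftInv_le {S : H →L[𝕜] H} (hS : S.IsPositive) {r : ℝ} (hr : 0 < r) (x : H) :
    r * ‖shiftInv S r x‖ ≤ ‖x‖ := by
  have h := re_inner_add_smul_self S (apply_shiftInv_add hS hr x)
  set z := shiftInv S r x
  have h1 := hS.re_inner_nonneg_left z
  have h2 : re (inner 𝕜 x z) ≤ ‖x‖ * ‖z‖ := re_inner_le_norm x z
  rcases (norm_nonneg z).eq_or_lt with h0 | h0
  · rw [← h0]; simp
  · refine le_of_mul_le_mul_right ?_ h0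
    nlinarith

/-- The residual `r ‖(S + r)⁻¹ x‖` of Tikhonov regularization is monotone in `r`. -/
theorem mul_norm_shiftInv_mono {S : H →L[𝕜] H} (hS : S.IsPositive) {r r' : ℝ} (hr : 0 < r)
    (hrr' : r ≤ r') (x : H) : r * ‖shiftInv S r x‖ ≤ r' * ‖shiftInv S r' x‖ := by
  have hr' : 0 < r' := hr.trans_le hrr'
  set z := shiftInv S r x with hz
  have hzx := apply_shiftInv_add hS hr x
  rw [← hz] at hzx
  set w := shiftInv S r' z with hw
  have hwz := apply_shiftInv_add hS hr' z
  rw [← hw] at hwz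
  have key : shiftInv S r' x = z - ((r' - r : ℝ) : 𝕜) • w := by
    refine shiftInv_eq hS hr' ?_
    rw [← hzx, ← hwz]
    simp only [map_sub, map_add, map_smul]
    module
  -- The larger residual vector is the smaller one plus a multiple of `S w`. The real inner product
  -- of the two summands is nonnegative because z = Sw + r'w, so the norm can only grow.
  have e : (r' : 𝕜) • shiftInv S r' x = (r : 𝕜) • z + ((r' - r : ℝ) : 𝕜) • S w := by
    rw [key]
    have : S w = z - (r' : 𝕜) • w := eq_sub_of_add_eq hwz
    rw [this]
    simp only [ofReal_sub]
    module
  have hpos : 0 ≤ re (inner 𝕜 z (S w)) := by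
    nth_rewrite 1 [← hwz]
    rw [inner_add_left, map_add, inner_smul_left, conj_ofReal, re_ofReal_mul,
      inner_self_eq_norm_sq_to_K]
    have h1 := hS.re_inner_nonneg_right w
    have h2 : (0 : ℝ) ≤ re ((‖S w‖ : 𝕜) ^ 2) := by
      rw [← ofReal_pow, ofReal_re]; positivity
    positivity
  have hsq : (r * ‖z‖) ^ 2 ≤ (r' * ‖shiftInv S r' x‖) ^ 2 := by
    have e1 : r' * ‖shiftInv S r' x‖ = ‖(r' : 𝕜) • shiftInv S r' x‖ := by
      rw [norm_smul, norm_ofReal, abs_of_pos hr']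
    have e2 : r * ‖z‖ = ‖(r : 𝕜) • z‖ := by rw [norm_smul, norm_ofReal, abs_of_pos hr]
    rw [e1, e, e2, @norm_add_sq 𝕜, inner_smul_left, inner_smul_right, conj_ofReal,
      re_ofReal_mul, re_ofReal_mul]
    have h3 : 0 ≤ r' - r := sub_nonneg.2 hrr'
    have h4 : 0 ≤ r * ((r' - r) * re (inner 𝕜 z (S w))) := by positivity
    have h5 : 0 ≤ ‖((r' - r : ℝ) : 𝕜) • S w‖ ^ 2 := by positivity
    linarith
  exact abs_le_of_sq_le_sq' hsq (by positivity) |>.2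

theorem continuousAt_shiftInv {S : H →L[𝕜] H} (hS : S.IsPositive) {r : ℝ} (hr : 0 < r) :
    ContinuousAt (shiftInv S) r := by
  obtain ⟨U, hU⟩ := isUnit_add_smul_one hS hr
  have h := NormedRing.inverse_continuousAt U
  rw [hU] at h
  have h2 : ContinuousAt (fun r : ℝ => S + (r : 𝕜) • (1 : H →L[𝕜] H)) r := by
    have := (continuous_ofReal (K := 𝕜)).continuousAt (x := r)
    fun_prop
  exact ContinuousAt.comp (f := fun r : ℝ => S + (r : 𝕜) • (1 : H →L[𝕜] H)) h h2

theorem isPositive_opT (A : H →L[𝕜] H) : (opT A).IsPositive := isPositive_adjoint_comp_self A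

theorem isPositive_opQ (A : H →L[𝕜] H) : (opQ A).IsPositive := isPositive_self_comp_adjoint A

/-- Pairing the equation for z with z gives ‖Az‖² + r‖z‖² ≤ ‖g‖‖Az‖; completing the square in ‖Az‖
leaves 4r‖z‖² ≤ ‖g‖². -/
theorem two_mul_sqrt_mul_norm_shiftInv_adjoint_le (A : H →L[𝕜] H) {r : ℝ} (hr : 0 < r) (g : H) :
    2 * √r * ‖shiftInv (opT A) r (adjoint A g)‖ ≤ ‖g‖ := by
  have h := re_inner_add_smul_self _ (apply_shiftInv_add (isPositive_opT A) hr (adjoint A g))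
  set z := shiftInv (opT A) r (adjoint A g)
  rw [re_inner_opT, adjoint_inner_left] at h
  have h2 : re (inner 𝕜 g (A z)) ≤ ‖g‖ * ‖A z‖ := re_inner_le_norm _ _
  have hs : √r ^ 2 = r := Real.sq_sqrt hr.le
  have hsq : (2 * √r * ‖z‖) ^ 2 ≤ ‖g‖ ^ 2 := by
    have : (2 * √r * ‖z‖) ^ 2 = 4 * (r * ‖z‖ ^ 2) := by rw [mul_pow, mul_pow, hs]; ring
    nlinarith [sq_nonneg (‖g‖ - 2 * ‖A z‖)]
  exact abs_le_of_sq_le_sq' hsq (norm_nonneg _) |>.2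

theorem shiftInv_opQ_apply (A : H →L[𝕜] H) {r : ℝ} (hr : 0 < r) (x : H) :
    shiftInv (opQ A) r (A x) = A (shiftInv (opT A) r x) := by
  refine shiftInv_eq (isPositive_opQ A) hr ?_
  have h := congrArg A (apply_shiftInv_add (isPositive_opT A) hr x)
  simpa [opQ, opT] using h

theorem mul_sq_norm_apply_shiftInv_le (A : H →L[𝕜] H) {r : ℝ} (hr : 0 < r) (x : H) :
    r * ‖A (shiftInv (opT A) r x)‖ ^ 2 ≤ ‖x‖ * (r * ‖shiftInv (opT A) r x‖) := by
  have h := re_inner_add_smul_self _ (apply_shiftInv_add (isPositive_opT A) hr x)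
  set z := shiftInv (opT A) r x
  rw [re_inner_opT] at h
  have h2 : re (inner 𝕜 x z) ≤ ‖x‖ * ‖z‖ := re_inner_le_norm _ _
  have h3 : ‖A z‖ ^ 2 ≤ ‖x‖ * ‖z‖ := by nlinarith [sq_nonneg ‖z‖]
  nlinarith

theorem shiftInv_opT_adjoint_apply (A : H →L[𝕜] H) {r : ℝ} (hr : 0 < r) (y : H) :
    shiftInv (opT A) r (adjoint A (A y)) = y - (r : 𝕜) • shiftInv (opT A) r y := by
  refine shiftInv_eq (isPositive_opT A) hr ?_
  have h := apply_shiftInv_add (isPositive_opT A) hr y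
  set z := shiftInv (opT A) r y
  have e : adjoint A (A y) = opT A y := rfl
  rw [e, map_sub, map_smul, eq_sub_of_add_eq h]
  module

/-- The projection of y onto (ker A)ᗮ also solves the equation, so minimality forces y to equal it;
(ker A)ᗮ is the closure of the range of A*. -/
theorem IsMinimalNormSolution.mem_closure {A : H →L[𝕜] H} {f y : H}
    (hy : IsMinimalNormSolution A f y) : y ∈ closure (range (adjoint A)) := by
  have hmem : y ∈ A.kerᗮ := by
    set K := A.ker
    have h1 : A (Kᗮ.starProjection y) = f := by
      have h := K.starProjection_add_starProjection_orthogonal y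
      have h2 : A (K.starProjection y) = 0 := (K.starProjection_apply_mem y : _)
      rw [← hy.1]
      nth_rewrite 2 [← h]
      rw [map_add, h2, zero_add]
    have h2 := hy.2 _ h1
    have h3 := K.norm_sq_eq_add_norm_sq_starProjection y
    rw [Submodule.mem_iff_norm_starProjection]
    refine le_antisymm ?_ h2
    exact abs_le_of_sq_le_sq' (by nlinarith [sq_nonneg ‖K.starProjection y‖]) (norm_nonneg _) |>.2
  rw [ContinuousLinearMap.orthogonal_ker] at hmem
  exact hmem

/-- A density argument: on the range of A* the quantity is O(√r), and r(T + r)⁻¹ is a contraction,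
so the limit extends to the closure. -/
theorem tendsto_mul_norm_shiftInv_opT (A : H →L[𝕜] H) {y : H}
    (hy : y ∈ closure (range (adjoint A))) :
    Tendsto (fun r => r * ‖shiftInv (opT A) r y‖) (𝓝[>] 0) (𝓝 0) := by
  rw [Metric.tendsto_nhds]
  intro ε hε
  obtain ⟨_, ⟨v, rfl⟩, hv⟩ := Metric.mem_closure_iff.1 hy (ε / 2) (half_pos hε)
  have h1 : Tendsto (fun r : ℝ => √r * ‖v‖) (𝓝[>] 0) (𝓝 0) := by
    have : Tendsto (fun r : ℝ => √r * ‖v‖) (𝓝 0) (𝓝 (√0 * ‖v‖)) :=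
      (Real.continuous_sqrt.mul_const _).tendsto 0
    simpa using this.mono_left nhdsWithin_le_nhds
  filter_upwards [h1.eventually_lt_const (half_pos hε), self_mem_nhdsWithin] with r hr1 hr
  have hr : 0 < r := hr
  have e : shiftInv (opT A) r y = shiftInv (opT A) r (y - adjoint A v)
      + shiftInv (opT A) r (adjoint A v) := by rw [← map_add, sub_add_cancel]
  have b1 := mul_norm_shiftInv_le (isPositive_opT A) hr (y - adjoint A v)
  have b2 := two_mul_sqrt_mul_norm_shiftInv_adjoint_le A hr v
  have b3 : r * ‖shiftInv (opT A) r (adjoint A v)‖ ≤ √r * ‖v‖ := by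
    have hs : √r * √r = r := Real.mul_self_sqrt hr.le
    have h0 : 0 ≤ √r * ‖shiftInv (opT A) r (adjoint A v)‖ := by positivity
    calc _ = √r * (√r * ‖shiftInv (opT A) r (adjoint A v)‖) := by rw [← mul_assoc, hs]
      _ ≤ _ := by gcongr; linarith
  have b4 : r * ‖shiftInv (opT A) r y‖ ≤ r * ‖shiftInv (opT A) r (y - adjoint A v)‖
      + r * ‖shiftInv (opT A) r (adjoint A v)‖ := by
    rw [← mul_add, e]
    gcongr
    exact norm_add_le _ _
  rw [dist_eq_norm] at hv
  rw [Real.dist_eq, sub_zero, abs_of_nonneg (by positivity)]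
  linarith

theorem tendsto_sqrt_mul_norm_apply_shiftInv (A : H →L[𝕜] H) {y : H}
    (hy : y ∈ closure (range (adjoint A))) :
    Tendsto (fun r => √r * ‖A (shiftInv (opT A) r y)‖) (𝓝[>] 0) (𝓝 0) := by
  have h := ((tendsto_mul_norm_shiftInv_opT A hy).const_mul ‖y‖).sqrt
  rw [mul_zero, Real.sqrt_zero] at h
  refine squeeze_zero' (Eventually.of_forall fun r => by positivity) ?_ h
  filter_upwards [self_mem_nhdsWithin] with r hr
  have hr : 0 < r := hr
  refine Real.le_sqrt_of_sq_le ?_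
  rw [mul_pow, Real.sq_sqrt hr.le]
  exact mul_sq_norm_apply_shiftInv_le A hr y

/-- Splitting of the discrepancy integrand into noise and approximation error. -/
theorem mul_norm_shiftInv_opQ_le (A : H →L[𝕜] H) {r : ℝ} (hr : 0 < r) (g y : H) :
    r * ‖shiftInv (opQ A) r g‖ ≤
      ‖g - A y‖ + √r * (√r * ‖A (shiftInv (opT A) r y)‖) := by
  have e : shiftInv (opQ A) r g = shiftInv (opQ A) r (g - A y) + A (shiftInv (opT A) r y) := by
    rw [← shiftInv_opQ_apply A hr, ← map_add, sub_add_cancel]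
  have b := mul_norm_shiftInv_le (isPositive_opQ A) hr (g - A y)
  have b2 := mul_le_mul_of_nonneg_left (norm_add_le (shiftInv (opQ A) r (g - A y))
    (A (shiftInv (opT A) r y))) hr.le
  rw [← mul_assoc, Real.mul_self_sqrt hr.le, e]
  linarith

theorem mul_norm_shiftInv_sub_le {S : H →L[𝕜] H} (hS : S.IsPositive) {r : ℝ} (hr : 0 < r)
    (f g : H) : r * ‖shiftInv S r f‖ - ‖g - f‖ ≤ r * ‖shiftInv S r g‖ := by
  have b := mul_norm_shiftInv_le hS hr (g - f)
  have b2 := mul_le_mul_of_nonneg_left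
    (norm_sub_norm_le (shiftInv S r f) (shiftInv S r g)) hr.le
  rw [norm_sub_rev, ← map_sub] at b2
  linarith

theorem norm_shiftInv_pos {S : H →L[𝕜] H} (hS : S.IsPositive) {r : ℝ} (hr : 0 < r)
    {f : H} (hf : f ≠ 0) : 0 < ‖shiftInv S r f‖ := by
  refine norm_pos_iff.2 fun h => hf ?_
  simpa [h] using (apply_shiftInv_add hS hr f).symm

end Operators

end DSM

namespace DSM

/-! ### Exponentially damped integrals -/

section Damped

open Real

/-- The solution `∫₀ᵗ e^{-(t-s)} g(s) ds` of `x' = -x + g`, `x(0) = 0`. -/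
noncomputable def damped (g : ℝ → ℝ) (t : ℝ) : ℝ := ∫ s in (0 : ℝ)..t, exp (-(t - s)) * g s

theorem damped_eq_exp_mul (g : ℝ → ℝ) (t : ℝ) :
    damped g t = exp (-t) * ∫ s in (0 : ℝ)..t, exp s * g s := by
  rw [damped, ← intervalIntegral.integral_const_mul]
  congr 1
  ext s
  rw [← mul_assoc, ← exp_add]
  ring_nf

theorem continuous_damped {g : ℝ → ℝ} (hg : Continuous g) : Continuous (damped g) := by
  have h : damped g = fun t => exp (-t) * ∫ s in (0 : ℝ)..t, exp s * g s :=
    funext (damped_eq_exp_mul g)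
  rw [h]
  refine Continuous.mul (by fun_prop) ?_
  exact intervalIntegral.continuous_primitive
    (fun a b => (Continuous.intervalIntegrable (by fun_prop) a b)) 0

theorem damped_split {g : ℝ → ℝ} (hg : Continuous g) (S t : ℝ) :
    damped g t = exp (-(t - S)) * damped g S + ∫ s in S..t, exp (-(t - s)) * g s := by
  have hi : ∀ a b, IntervalIntegrable (fun s => exp (-(t - s)) * g s) MeasureTheory.volume a b :=
    fun a b => Continuous.intervalIntegrable (by fun_prop) a b
  rw [damped, ← intervalIntegral.integral_add_adjacent_intervals (hi 0 S) (hi S t), damped,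
    ← intervalIntegral.integral_const_mul]
  congr 2
  ext s
  rw [← mul_assoc, ← exp_add]
  ring_nf

theorem integral_exp_neg_mul_sub {k : ℝ} (hk : k ≠ 0) (S t : ℝ) :
    ∫ s in S..t, exp (-(k * (t - s))) = (1 - exp (-(k * (t - S)))) / k := by
  have h : ∀ s ∈ uIcc S t, HasDerivAt (fun s => exp (-(k * (t - s))) / k)
      (exp (-(k * (t - s)))) s := by
    intro s _
    have h1 : HasDerivAt (fun s => -(k * (t - s))) k s := by
      have h2 := (((hasDerivAt_id s).const_sub t).const_mul k).neg
      simp only [mul_neg, mul_one, neg_neg] at h2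
      exact h2
    simpa [hk] using (h1.exp.div_const k)
  rw [intervalIntegral.integral_eq_sub_of_hasDerivAt h
    (Continuous.intervalIntegrable (by fun_prop) _ _)]
  simp
  ring

theorem integral_exp_neg_sub_mul_const (S t M : ℝ) :
    ∫ s in S..t, exp (-(t - s)) * M = (1 - exp (-(t - S))) * M := by
  have h := integral_exp_neg_mul_sub one_ne_zero S t
  simp only [one_mul, div_one] at h
  rw [intervalIntegral.integral_mul_const, h]

theorem damped_le {g : ℝ → ℝ} (hg : Continuous g) {S t M : ℝ} (hSt : S ≤ t)
    (h : ∀ s ∈ Icc S t, g s ≤ M) :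
    damped g t ≤ exp (-(t - S)) * damped g S + (1 - exp (-(t - S))) * M := by
  rw [damped_split hg S t, ← integral_exp_neg_sub_mul_const]
  gcongr
  refine intervalIntegral.integral_mono_on hSt (Continuous.intervalIntegrable (by fun_prop) _ _)
    (Continuous.intervalIntegrable (by fun_prop) _ _) fun s hs => ?_
  exact mul_le_mul_of_nonneg_left (h s hs) (exp_pos _).le

theorem le_damped {g : ℝ → ℝ} (hg : Continuous g) {S t M : ℝ} (hSt : S ≤ t)
    (h : ∀ s ∈ Icc S t, M ≤ g s) :
    exp (-(t - S)) * damped g S + (1 - exp (-(t - S))) * M ≤ damped g t := by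
  rw [damped_split hg S t, ← integral_exp_neg_sub_mul_const]
  gcongr
  refine intervalIntegral.integral_mono_on hSt (Continuous.intervalIntegrable (by fun_prop) _ _)
    (Continuous.intervalIntegrable (by fun_prop) _ _) fun s hs => ?_
  exact mul_le_mul_of_nonneg_left (h s hs) (exp_pos _).le

theorem damped_zero (g : ℝ → ℝ) : damped g 0 = 0 := by simp [damped]

theorem damped_mono {g₁ g₂ : ℝ → ℝ} (h₁ : Continuous g₁) (h₂ : Continuous g₂) {t : ℝ} (ht : 0 ≤ t)
    (h : ∀ s ∈ Icc 0 t, g₁ s ≤ g₂ s) : damped g₁ t ≤ damped g₂ t :=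
  intervalIntegral.integral_mono_on ht (Continuous.intervalIntegrable (by fun_prop) _ _)
    (Continuous.intervalIntegrable (by fun_prop) _ _) fun s hs =>
      mul_le_mul_of_nonneg_left (h s hs) (exp_pos _).le

theorem damped_const_add_le {g : ℝ → ℝ} (hg : Continuous g) {K : ℝ} (hK : 0 ≤ K) (t : ℝ) :
    damped (fun s => K + g s) t ≤ K + damped g t := by
  have h : damped (fun s => K + g s) t = (1 - exp (-t)) * K + damped g t := by
    have := integral_exp_neg_sub_mul_const 0 t K
    rw [sub_zero] at this
    rw [← this, damped, damped, ← intervalIntegral.integral_add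
      (Continuous.intervalIntegrable (by fun_prop) _ _)
      (Continuous.intervalIntegrable (by fun_prop) _ _)]
    simp only [mul_add]
  have := mul_nonneg (exp_pos (-t)).le hK
  rw [h]
  linarith

theorem tendsto_exp_neg_half_sub (S : ℝ) :
    Tendsto (fun t => exp (-((t - S) / 2))) atTop (𝓝 0) :=
  tendsto_exp_neg_atTop_nhds_zero.comp
    ((tendsto_atTop_add_const_right _ (-S) tendsto_id).atTop_div_const two_pos)

/-- If `g` is dominated by every multiple of a weight `b` which decays slower than `e^{-t/2}`,
then so is the damped integral of `g`. -/
theorem eventually_damped_le {g b : ℝ → ℝ} (hg : Continuous g) (hb : ∀ t, 0 < b t)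
    (hslow : ∃ S₀, ∀ s t, S₀ ≤ s → s ≤ t → b s ≤ exp ((t - s) / 2) * b t)
    (hgb : ∀ η > 0, ∀ᶠ s in atTop, g s ≤ η * b s) {η : ℝ} (hη : 0 < η) :
    ∀ᶠ t in atTop, damped g t ≤ η * b t := by
  obtain ⟨S₀, hS₀⟩ := hslow
  obtain ⟨S₁, hS₁⟩ := eventually_atTop.1 (hgb (η / 4) (by positivity))
  set S := max S₀ S₁ with hS
  have hlim : Tendsto (fun t => exp (-((t - S) / 2)) * (|damped g S| / b S)) atTop (𝓝 0) := by
    simpa using (tendsto_exp_neg_half_sub S).mul_const (|damped g S| / b S)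
  filter_upwards [hlim.eventually_lt_const (half_pos hη), eventually_ge_atTop S] with t ht hSt
  have hbS := hb S
  have hbt := hb t
  have h1 : exp (-(t - S)) * damped g S ≤ η / 2 * b t := by
    -- One half of the exponent sends the transient to zero; the other half is absorbed by the slow
    -- decay of b.
    have e : exp (-(t - S)) = exp (-((t - S) / 2)) * exp (-((t - S) / 2)) := by
      rw [← exp_add]; ring_nf
    have e2 : exp (-((t - S) / 2)) * b S ≤ b t := by
      have := mul_le_mul_of_nonneg_left (hS₀ S t (le_max_left _ _) hSt)
        (exp_pos (-((t - S) / 2))).le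
      rwa [← mul_assoc, ← exp_add, neg_add_cancel, exp_zero, one_mul] at this
    calc exp (-(t - S)) * damped g S ≤ exp (-(t - S)) * |damped g S| := by
          gcongr; exact le_abs_self _
      _ = exp (-((t - S) / 2)) * (|damped g S| / b S) * (exp (-((t - S) / 2)) * b S) := by
          rw [e]; field_simp
      _ ≤ η / 2 * b t := by gcongr
  have h2 : ∫ s in S..t, exp (-(t - s)) * g s ≤ η / 2 * b t := by
    -- Slow decay of b costs a factor e^{(t-s)/2}. The remaining kernel e^{-(t-s)/2} has integral at
    -- most 2, which turns η/4 into η/2.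
    have h3 : ∫ s in S..t, exp (-(t - s)) * g s
        ≤ ∫ s in S..t, exp (-(1 / 2 * (t - s))) * (η / 4 * b t) := by
      refine intervalIntegral.integral_mono_on hSt (Continuous.intervalIntegrable (by fun_prop) _ _)
        (Continuous.intervalIntegrable (by fun_prop) _ _) fun s hs => ?_
      have hg1 := hS₁ s ((le_max_right _ _).trans hs.1)
      have hb1 := hS₀ s t ((le_max_left _ _).trans hs.1) hs.2
      calc exp (-(t - s)) * g s ≤ exp (-(t - s)) * (η / 4 * (exp ((t - s) / 2) * b t)) := by
            gcongr
            exact hg1.trans (by gcongr)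
        _ = (exp (-(t - s)) * exp ((t - s) / 2)) * (η / 4 * b t) := by ring
        _ = _ := by rw [← exp_add]; ring_nf
    rw [intervalIntegral.integral_mul_const, integral_exp_neg_mul_sub (by norm_num)] at h3
    have h4 := exp_pos (-(1 / 2 * (t - S)))
    have h5 : 0 < η / 4 * b t := by positivity
    nlinarith
  rw [damped_split hg S t]
  linarith

/-- With the integrating factor e^s, the derivative of e^s v(s) is e^s F(s), of norm at most e^s
G(s). -/
theorem norm_le_exp_mul_add_damped {E : Type*} [NormedAddCommGroup E] [NormedSpace ℝ E]
    {v F : ℝ → E} (hv : ∀ t, 0 ≤ t → HasDerivWithinAt v (-v t + F t) (Ici 0) t)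
    {G : ℝ → ℝ} (hG : Continuous G) {t : ℝ} (ht : 0 ≤ t) (hF : ∀ s ∈ Icc 0 t, ‖F s‖ ≤ G s) :
    ‖v t‖ ≤ exp (-t) * ‖v 0‖ + damped G t := by
  have hw : ∀ s, 0 ≤ s → HasDerivWithinAt (fun s => exp s • v s) (exp s • F s) (Ici 0) s := by
    intro s hs
    have := (Real.hasDerivAt_exp s).hasDerivWithinAt.smul (hv s hs)
    have e : exp s • F s = exp s • (-v s + F s) + exp s • v s := by module
    rw [e]
    exact this
  have hB : ∀ s, HasDerivAt (fun s => ‖v 0‖ + ∫ x in (0 : ℝ)..s, exp x * G x)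
      (exp s * G s) s := fun s => by
    have hc : Continuous fun x => exp x * G x := by fun_prop
    exact ((hc.integral_hasStrictDerivAt 0 s).hasDerivAt).const_add _
  have key := image_norm_le_of_norm_deriv_right_le_deriv_boundary'
    (f := fun s => exp s • v s) (f' := fun s => exp s • F s) (a := 0) (b := t)
    (fun s hs => ((hw s hs.1).continuousWithinAt).mono Icc_subset_Ici_self)
    (fun s hs => (hw s hs.1).mono (Ici_subset_Ici.2 hs.1))
    (B := fun s => ‖v 0‖ + ∫ x in (0 : ℝ)..s, exp x * G x) (B' := fun s => exp s * G s)
    (by simp) (fun s _ => (hB s).continuousAt.continuousWithinAt)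
    (fun s _ => (hB s).hasDerivWithinAt)
    (fun s hs => by
      rw [norm_smul, Real.norm_of_nonneg (exp_pos _).le]
      gcongr
      exact hF s (Ico_subset_Icc_self hs)) (right_mem_Icc.2 ht)
  have key' := mul_le_mul_of_nonneg_left key (exp_pos (-t)).le
  rw [norm_smul, Real.norm_of_nonneg (exp_pos _).le, ← mul_assoc, ← exp_add, neg_add_cancel,
    exp_zero, one_mul, mul_add, ← damped_eq_exp_mul] at key'
  exact key'

/-- The damped integral of an antitone function, once above a level, crosses that level at most
once. -/
theorem damped_unique {g : ℝ → ℝ} (hg : Continuous g) (hanti : AntitoneOn g (Ici 0))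
    {τ M s₁ s₂ : ℝ} (hτ : 0 ≤ τ) (hM : M < damped g τ) (hs : τ ≤ s₁) (hs12 : s₁ < s₂)
    (h₁ : damped g s₁ = M) : damped g s₂ < M := by
  have hlt : τ < s₁ := hs.lt_of_ne fun h => by rw [h, h₁] at hM; exact lt_irrefl _ hM
  have b1 := le_damped hg hs fun s hs => hanti (hτ.trans hs.1) (hτ.trans (hs.1.trans hs.2)) hs.2
  have b2 := damped_le hg hs12.le (M := g s₁) fun s hs =>
    hanti (hτ.trans hlt.le) (hτ.trans (hlt.le.trans hs.1)) hs.1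
  have e1 : exp (-(s₁ - τ)) < 1 := exp_lt_one_iff.2 (by linarith)
  have e2 : exp (-(s₂ - s₁)) < 1 := exp_lt_one_iff.2 (by linarith)
  have e3 := exp_pos (-(s₁ - τ))
  rw [h₁] at b1 b2
  -- Otherwise g ≥ M on [τ, s₁], and the value at s₁ would be at least an average of `damped g τ` >
  -- M and a number ≥ M, with positive weight on the former.
  have hgs : g s₁ < M := by
    by_contra! hcon
    nlinarith
  nlinarith

end Damped

end DSM

namespace DSM

/-! ### Slow decay of the regularizer -/

section Regularizer

variable {a : ℝ → ℝ}

/-- The regularizer `a`, extended to negative arguments by the constant `a 0`. -/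
def extend (a : ℝ → ℝ) (t : ℝ) : ℝ := a (max t 0)

theorem extend_of_nonneg {t : ℝ} (ht : 0 ≤ t) : extend a t = a t := by rw [extend, max_eq_left ht]

theorem IsRegularizer.extend_pos (ha : IsRegularizer a) (t : ℝ) : 0 < extend a t :=
  ha.pos _ (le_max_right _ _)

theorem IsRegularizer.continuous_extend (ha : IsRegularizer a) : Continuous (extend a) :=
  ha.differentiableOn.continuousOn.comp_continuous (by fun_prop) fun t => mem_Ici.2 (le_max_right t 0)

theorem IsRegularizer.antitone_extend (ha : IsRegularizer a) : Antitone (extend a) :=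
  fun s t hst => ha.antitoneOn (mem_Ici.2 (le_max_right s 0)) (mem_Ici.2 (le_max_right t 0))
    (max_le_max_right 0 hst)

theorem IsRegularizer.tendsto_extend (ha : IsRegularizer a) :
    Tendsto (extend a) atTop (𝓝[>] 0) := by
  refine tendsto_nhdsWithin_iff.2 ⟨?_, Eventually.of_forall ha.extend_pos⟩
  refine ha.tendsto_zero.congr' ?_
  filter_upwards [eventually_ge_atTop 0] with t ht
  rw [extend_of_nonneg ht]

theorem IsRegularizer.tendsto_sqrt_extend (ha : IsRegularizer a) :
    Tendsto (fun t => √(extend a t)) atTop (𝓝 0) := by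
  simpa using (ha.tendsto_extend.mono_right nhdsWithin_le_nhds).sqrt

/-- Eventually a'/a > -1, so e^t a(t) is nondecreasing; take square roots. -/
theorem IsRegularizer.sqrt_extend_le (ha : IsRegularizer a) :
    ∃ S₀, ∀ s t, S₀ ≤ s → s ≤ t →
      √(extend a s) ≤ Real.exp ((t - s) / 2) * √(extend a t) := by
  obtain ⟨S₁, hS₁⟩ := eventually_atTop.1
    (ha.tendsto_deriv_div.eventually_const_lt (show (-1 : ℝ) < 0 by norm_num))
  -- The bound 1 keeps every point of [S, ∞) interior to [0, ∞), where a has a two-sided derivative.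
  set S := max S₁ 1
  have hS0 : 0 < S := one_pos.trans_le (le_max_right _ _)
  have hd : ∀ t, S ≤ t → HasDerivAt (fun t => Real.exp t * a t)
      (Real.exp t * a t + Real.exp t * deriv a t) t := fun t ht => by
    have h : DifferentiableAt ℝ a t :=
      ha.differentiableOn.differentiableAt (Ici_mem_nhds (hS0.trans_le ht))
    exact (Real.hasDerivAt_exp t).mul h.hasDerivAt
  have hmono : MonotoneOn (fun t => Real.exp t * a t) (Ici S) := by
    refine monotoneOn_of_deriv_nonneg (convex_Ici S)
      (fun t ht => (hd t ht).continuousAt.continuousWithinAt)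
      (fun t ht => (hd t (interior_subset ht)).differentiableAt.differentiableWithinAt)
      fun t ht => ?_
    have ht := interior_subset ht
    have hpos := ha.pos t (hS0.le.trans ht)
    have h := hS₁ t ((le_max_left _ _).trans ht)
    rw [lt_div_iff₀ hpos] at h
    rw [(hd t ht).deriv, ← mul_add]
    exact mul_nonneg (Real.exp_pos _).le (by linarith)
  refine ⟨S, fun s t hs hst => ?_⟩
  have h := hmono hs (hs.trans hst) hst
  rw [extend_of_nonneg (hS0.le.trans hs), extend_of_nonneg (hS0.le.trans (hs.trans hst))]
  have e : Real.exp ((t - s) / 2) = √(Real.exp (t - s)) := (Real.sqrt_eq_rpow _ ▸ by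
    rw [← Real.exp_mul]; ring_nf)
  rw [e, ← Real.sqrt_mul (Real.exp_pos _).le]
  refine Real.sqrt_le_sqrt ?_
  rw [Real.exp_sub, div_mul_eq_mul_div, le_div_iff₀ (Real.exp_pos _), mul_comm]
  exact h

end Regularizer

/-! ### The discrepancy equation and convergence of the flow -/

section Convergence

open ContinuousLinearMap

variable {𝕜 H : Type*} [RCLike 𝕜] [NormedAddCommGroup H] [InnerProductSpace 𝕜 H]
  [CompleteSpace H] {A : H →L[𝕜] H} {a : ℝ → ℝ}

theorem continuous_shiftInv_extend (ha : IsRegularizer a) {S : H →L[𝕜] H} (hS : S.IsPositive)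
    (x : H) : Continuous fun s => shiftInv S (extend a s) x :=
  (continuous_iff_continuousAt.2 fun s => (continuousAt_shiftInv hS (ha.extend_pos s)).comp
    ha.continuous_extend.continuousAt).clm_apply continuous_const

/-- The integrand `a(s) ‖(S + a(s))⁻¹ g‖`, for `S = A A*` that of the discrepancy equation. -/
noncomputable def residual (S : H →L[𝕜] H) (a : ℝ → ℝ) (g : H) (s : ℝ) : ℝ :=
  extend a s * ‖shiftInv S (extend a s) g‖

theorem continuous_residual (ha : IsRegularizer a) {S : H →L[𝕜] H} (hS : S.IsPositive) (g : H) :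
    Continuous (residual S a g) :=
  ha.continuous_extend.mul (continuous_shiftInv_extend ha hS g).norm

theorem antitone_residual (ha : IsRegularizer a) {S : H →L[𝕜] H} (hS : S.IsPositive) (g : H) :
    Antitone (residual S a g) :=
  fun _ t hst => mul_norm_shiftInv_mono hS (ha.extend_pos t) (ha.antitone_extend hst) g

theorem discrepancy_eq_damped (g : H) {t : ℝ} (ht : 0 ≤ t) :
    discrepancy A a g t = damped (residual (opQ A) a g) t := by
  refine intervalIntegral.integral_congr fun s hs => ?_
  rw [uIcc_of_le ht] at hs
  simp only [residual, extend_of_nonneg hs.1]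

/-- The approximation error `a(s) ‖A (A* A + a(s))⁻¹ y‖`. -/
noncomputable def approxError (A : H →L[𝕜] H) (a : ℝ → ℝ) (y : H) (s : ℝ) : ℝ :=
  √(extend a s) * (√(extend a s) * ‖A (shiftInv (opT A) (extend a s) y)‖)

theorem continuous_approxError (ha : IsRegularizer a) (y : H) :
    Continuous (approxError A a y) := by
  have h1 := ha.continuous_extend
  have h2 := continuous_shiftInv_extend ha (isPositive_opT A) y
  unfold approxError
  fun_prop

theorem eventually_damped_approxError_le (ha : IsRegularizer a) {y : H}
    (hy : y ∈ closure (range (adjoint A))) {η : ℝ} (hη : 0 < η) :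
    ∀ᶠ t in atTop, damped (approxError A a y) t ≤ η * √(extend a t) := by
  refine eventually_damped_le (continuous_approxError ha y)
    (fun t => Real.sqrt_pos.2 (ha.extend_pos t)) ha.sqrt_extend_le (fun ε hε => ?_) hη
  have h := (tendsto_sqrt_mul_norm_apply_shiftInv A hy).comp ha.tendsto_extend
  filter_upwards [h.eventually_le_const hε] with s hs
  rw [approxError, mul_comm ε]
  exact mul_le_mul_of_nonneg_left hs (Real.sqrt_nonneg _)

/-- The averaging lemma with constant weight 1. -/
theorem eventually_damped_residual_opT_le (ha : IsRegularizer a) {y : H}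
    (hy : y ∈ closure (range (adjoint A))) {η : ℝ} (hη : 0 < η) :
    ∀ᶠ t in atTop, damped (residual (opT A) a y) t ≤ η := by
  have h := eventually_damped_le (b := fun _ => 1) (continuous_residual ha (isPositive_opT A) y)
    (fun _ => one_pos) ⟨0, fun s t _ hst => by
      simpa using div_nonneg (sub_nonneg.2 hst) two_pos.le⟩ (fun ε hε => ?_) hη
  · simpa using h
  · rw [mul_one]
    exact ((tendsto_mul_norm_shiftInv_opT A hy).comp ha.tendsto_extend).eventually_le_const hε

theorem damped_residual_opQ_le (ha : IsRegularizer a) {g y : H} {δ : ℝ} (hg : ‖g - A y‖ ≤ δ)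
    {t : ℝ} (ht : 0 ≤ t) :
    damped (residual (opQ A) a g) t ≤ δ + damped (approxError A a y) t := by
  have hc := continuous_approxError (A := A) ha y
  refine (damped_mono (continuous_residual ha (isPositive_opQ A) g)
    (g₂ := fun s => δ + approxError A a y s) (by fun_prop) ht fun s _ => ?_).trans
    (damped_const_add_le hc ((norm_nonneg _).trans hg) t)
  exact (mul_norm_shiftInv_opQ_le A (ha.extend_pos s) g y).trans (by
    rw [approxError]; linarith)

theorem le_damped_residual_opQ (ha : IsRegularizer a) {f g : H} {δ : ℝ} (hg : ‖g - f‖ ≤ δ)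
    {t : ℝ} (ht : 0 ≤ t) :
    (1 - Real.exp (-t)) * (residual (opQ A) a f t - δ) ≤ damped (residual (opQ A) a g) t := by
  have h := le_damped (continuous_residual ha (isPositive_opQ A) g) ht
    fun s hs => antitone_residual ha (isPositive_opQ A) g hs.2
  rw [damped_zero, mul_zero, zero_add, sub_zero] at h
  refine le_trans (mul_le_mul_of_nonneg_left ?_ ?_) h
  · exact le_trans (by rw [residual]; linarith)
      (mul_norm_shiftInv_sub_le (isPositive_opQ A) (ha.extend_pos t) f g)
  · simpa using ht

theorem norm_shiftInv_adjoint_sub_le (A : H →L[𝕜] H) {r : ℝ} (hr : 0 < r) {g y : H} {δ : ℝ}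
    (hg : ‖g - A y‖ ≤ δ) :
    ‖shiftInv (opT A) r (adjoint A g) - y‖ ≤
      δ / (2 * √r) + r * ‖shiftInv (opT A) r y‖ := by
  have e : shiftInv (opT A) r (adjoint A g) - y =
      shiftInv (opT A) r (adjoint A (g - A y)) - (r : 𝕜) • shiftInv (opT A) r y := by
    rw [map_sub, map_sub, shiftInv_opT_adjoint_apply A hr]
    abel
  have hs := Real.sqrt_pos.2 hr
  rw [e]
  refine (norm_sub_le _ _).trans (add_le_add ?_ ?_)
  · rw [le_div_iff₀ (by positivity), mul_comm]
    exact (two_mul_sqrt_mul_norm_shiftInv_adjoint_le A hr _).trans hg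
  · rw [norm_smul, RCLike.norm_ofReal, abs_of_pos hr]

theorem IsSolution.norm_sub_le [NormedSpace ℝ H] (ha : IsRegularizer a) {g y u₀ : H} {δ : ℝ}
    (hg : ‖g - A y‖ ≤ δ) {u : ℝ → H} (hu : IsSolution A a g u₀ u) {t : ℝ} (ht : 0 ≤ t) :
    ‖u t - y‖ ≤ Real.exp (-t) * ‖u₀ - y‖ +
      (δ / (2 * √(extend a t)) + damped (residual (opT A) a y) t) := by
  have hδ : 0 ≤ δ := (norm_nonneg _).trans hg
  have hc := continuous_residual ha (isPositive_opT A) y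
  have h := norm_le_exp_mul_add_damped (v := fun t => u t - y)
    (F := fun t => shiftInv (opT A) (a t) (adjoint A g) - y)
    (fun s hs => by
      have := (hu.2 s hs).sub_const y
      convert this using 1
      abel)
    -- The noise term is frozen at the final time t, where it is largest because a is nonincreasing.
    (G := fun s => δ / (2 * √(extend a t)) + residual (opT A) a y s) (by fun_prop) ht
    fun s hs => by
      rw [← extend_of_nonneg (a := a) hs.1]
      refine (norm_shiftInv_adjoint_sub_le A (ha.extend_pos s) hg).trans
        (add_le_add_left ?_ _)
      have := Real.sqrt_pos.2 (ha.extend_pos t)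
      have := Real.sqrt_le_sqrt (ha.antitone_extend hs.2)
      gcongr
  rw [hu.1] at h
  exact h.trans (add_le_add_right (damped_const_add_le hc (by positivity) t) _)

/-- Once the discrepancy exceeds the level `c δ` at `τ`, it equals `c δ` exactly once on
`[τ, ∞)`. -/
theorem existsUnique_discrepancy_eq (ha : IsRegularizer a) {g y : H}
    (hy : y ∈ closure (range (adjoint A))) {c δ : ℝ} (hc : 1 < c) (hδ : 0 < δ)
    (hg : ‖g - A y‖ ≤ δ) {τ : ℝ} (hτ : 0 ≤ τ) (hlarge : c * δ < discrepancy A a g τ) :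
    ∃ t, τ ≤ t ∧ discrepancy A a g t = c * δ ∧
      ∀ s, τ ≤ s → discrepancy A a g s = c * δ → s = t := by
  have hcont := continuous_residual ha (isPositive_opQ A) g
  have hanti := (antitone_residual ha (isPositive_opQ A) g).antitoneOn (Ici 0)
  rw [discrepancy_eq_damped g hτ] at hlarge
  obtain ⟨t', h1, h2, hτt'⟩ := ((eventually_damped_approxError_le ha hy one_pos).and
    ((ha.tendsto_sqrt_extend.eventually_lt_const
      (mul_pos (sub_pos.2 hc) hδ)).and (eventually_ge_atTop τ))).exists
  have hsmall : damped (residual (opQ A) a g) t' ≤ c * δ := by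
    have := damped_residual_opQ_le ha hg (hτ.trans hτt')
    linarith
  obtain ⟨t, ht, hteq⟩ := intermediate_value_Icc' hτt' (continuous_damped hcont).continuousOn
    ⟨hsmall, hlarge.le⟩
  refine ⟨t, ht.1, by rw [discrepancy_eq_damped g (hτ.trans ht.1), hteq], fun s hs hseq => ?_⟩
  rw [discrepancy_eq_damped g (hτ.trans hs)] at hseq
  rcases lt_trichotomy s t with hst | hst | hst
  · exact absurd hteq (damped_unique hcont hanti hτ hlarge hs hst hseq).ne
  · exact hst
  · exact absurd hseq (damped_unique hcont hanti hτ hlarge ht.1 hst hteq).ne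

theorem eventually_lt_discrepancy (ha : IsRegularizer a) {f : H} (hf : f ≠ 0) {fδ : ℝ → H}
    (hfδ : ∀ᶠ δ in 𝓝[>] (0 : ℝ), ‖fδ δ - f‖ ≤ δ) (c : ℝ) {τ : ℝ} (hτ : 0 < τ) :
    ∀ᶠ δ in 𝓝[>] (0 : ℝ), c * δ < discrepancy A a (fδ δ) τ := by
  have hpos : 0 < (1 - Real.exp (-τ)) * residual (opQ A) a f τ := by
    refine mul_pos (by simpa using hτ) (mul_pos (ha.extend_pos τ) ?_)
    exact norm_shiftInv_pos (isPositive_opQ A) (ha.extend_pos τ) hf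
  have hlim : Tendsto (fun δ : ℝ => (1 - Real.exp (-τ)) * (residual (opQ A) a f τ - δ) - c * δ)
      (𝓝[>] 0) (𝓝 ((1 - Real.exp (-τ)) * residual (opQ A) a f τ)) := by
    have : Continuous fun δ : ℝ =>
      (1 - Real.exp (-τ)) * (residual (opQ A) a f τ - δ) - c * δ := by fun_prop
    simpa using (this.tendsto 0).mono_left nhdsWithin_le_nhds
  filter_upwards [hlim.eventually_const_lt hpos, hfδ] with δ h1 h2
  rw [discrepancy_eq_damped _ hτ.le]
  have := le_damped_residual_opQ (A := A) ha h2 hτ.le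
  linarith

theorem tendsto_solution [NormedSpace ℝ H] (ha : IsRegularizer a) {y u₀ : H}
    (hy : y ∈ closure (range (adjoint A))) {c : ℝ} (hc : 1 < c) {fδ : ℝ → H} {u : ℝ → ℝ → H}
    {tδ : ℝ → ℝ} (hfδ : ∀ᶠ δ in 𝓝[>] (0 : ℝ), ‖fδ δ - A y‖ ≤ δ)
    (hu : ∀ᶠ δ in 𝓝[>] (0 : ℝ), IsSolution A a (fδ δ) u₀ (u δ))
    (htδ : ∀ᶠ δ in 𝓝[>] (0 : ℝ), discrepancy A a (fδ δ) (tδ δ) = c * δ)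
    (hlim : Tendsto tδ (𝓝[>] (0 : ℝ)) atTop) :
    Tendsto (fun δ => u δ (tδ δ)) (𝓝[>] (0 : ℝ)) (𝓝 y) := by
  rw [Metric.tendsto_nhds]
  intro ε hε
  have hc' : 0 < c - 1 := sub_pos.2 hc
  have hexp : Tendsto (fun t => Real.exp (-t) * ‖u₀ - y‖) atTop (𝓝 0) := by
    simpa using Real.tendsto_exp_neg_atTop_nhds_zero.mul_const ‖u₀ - y‖
  filter_upwards [hlim.eventually (eventually_ge_atTop 0),
    hlim.eventually (hexp.eventually_lt_const (show 0 < ε / 3 by positivity)),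
    hlim.eventually (eventually_damped_residual_opT_le (A := A) ha hy
      (show 0 < ε / 3 by positivity)),
    -- This constant makes (c - 1)δ ≤ (c - 1)(2ε/3)√a(t_δ), that is, δ/(2√a(t_δ)) ≤ ε/3.
    hlim.eventually (eventually_damped_approxError_le (A := A) ha hy
      (show 0 < (c - 1) * (2 * (ε / 3)) by positivity)), hfδ, hu, htδ]
    with δ ht h1 h2 h3 hg hsol heq
  rw [discrepancy_eq_damped _ ht] at heq
  have hs := Real.sqrt_pos.2 (ha.extend_pos (tδ δ))
  have h4 := damped_residual_opQ_le (A := A) ha hg ht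
  have h5 : δ / (2 * √(extend a (tδ δ))) ≤ ε / 3 := by
    rw [div_le_iff₀ (by positivity)]
    refine le_of_mul_le_mul_left ?_ hc'
    linarith
  have h6 := hsol.norm_sub_le ha hg ht
  rw [dist_eq_norm]
  linarith

end Convergence

end DSM

/-! ### The main theorem -/

theorem theorem1 {𝕜 H : Type*} [RCLike 𝕜] [NormedAddCommGroup H] [InnerProductSpace 𝕜 H]
    [CompleteSpace H] [NormedSpace ℝ H] [IsScalarTower ℝ 𝕜 H]
    (A : H →L[𝕜] H) (f y : H) (hy : DSM.IsMinimalNormSolution A f y)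
    (a : ℝ → ℝ) (ha : DSM.IsRegularizer a)
    (c : ℝ) (hc : c ∈ Ioo (1 : ℝ) 2)
    (δ₀ : ℝ) (hδ₀ : 0 < δ₀) (fδ : ℝ → H)
    (hfδ : ∀ δ ∈ Ioo 0 δ₀, ‖fδ δ - f‖ ≤ δ)
    (hfδ_large : ∀ δ ∈ Ioo 0 δ₀, c * δ < ‖fδ δ‖)
    (hgrowth : ∀ δ ∈ Ioo 0 δ₀, Tendsto
      (fun t => Real.exp t * a t * ‖DSM.shiftInv (DSM.opQ A) (a t) (fδ δ)‖) atTop atTop)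
    (u₀ : H) (u : ℝ → ℝ → H)
    (hu : ∀ δ ∈ Ioo 0 δ₀, DSM.IsSolution A a (fδ δ) u₀ (u δ)) :
    ∃ tδ : ℝ → ℝ,
      (∀ τ : ℝ, 0 < τ → ∀ᶠ δ in 𝓝[>] (0 : ℝ),
        τ ≤ tδ δ ∧ DSM.discrepancy A a (fδ δ) (tδ δ) = c * δ ∧
          ∀ s : ℝ, τ ≤ s → DSM.discrepancy A a (fδ δ) s = c * δ → s = tδ δ) ∧
      Tendsto tδ (𝓝[>] (0 : ℝ)) atTop ∧
      Tendsto (fun δ => u δ (tδ δ)) (𝓝[>] (0 : ℝ)) (𝓝 y) := by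
  have hyc := hy.mem_closure
  obtain ⟨rfl, -⟩ := hy
  -- If f = 0, then cδ < ‖f_δ‖ ≤ δ, impossible for c > 1.
  have hf : A y ≠ 0 := by
    intro h0
    have hmem : δ₀ / 2 ∈ Ioo 0 δ₀ := ⟨half_pos hδ₀, half_lt_self hδ₀⟩
    have h1 := hfδ _ hmem
    have h2 := hfδ_large _ hmem
    rw [h0, sub_zero] at h1
    nlinarith [hc.1]
  have hδ : ∀ᶠ δ in 𝓝[>] (0 : ℝ), δ ∈ Ioo 0 δ₀ := Ioo_mem_nhdsGT hδ₀
  have hfδ' : ∀ᶠ δ in 𝓝[>] (0 : ℝ), ‖fδ δ - A y‖ ≤ δ := hδ.mono hfδ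
  -- A choice independent of τ: the damped integral starts from 0, so (*) may have further solutions
  -- near 0, but for small δ the largest one is the solution beyond τ.
  set tδ : ℝ → ℝ := fun δ => sSup {t | 0 ≤ t ∧ DSM.discrepancy A a (fδ δ) t = c * δ}
  have hsolve : ∀ τ : ℝ, 0 < τ → ∀ᶠ δ in 𝓝[>] (0 : ℝ),
      τ ≤ tδ δ ∧ DSM.discrepancy A a (fδ δ) (tδ δ) = c * δ ∧
        ∀ s : ℝ, τ ≤ s → DSM.discrepancy A a (fδ δ) s = c * δ → s = tδ δ := by
    intro τ hτ
    filter_upwards [DSM.eventually_lt_discrepancy (A := A) ha hf hfδ' c hτ, hfδ', hδ]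
      with δ h1 h2 h3
    obtain ⟨t, ht, hteq, huniq⟩ :=
      DSM.existsUnique_discrepancy_eq ha hyc hc.1 h3.1 h2 hτ.le h1
    have hgreatest : IsGreatest {t | 0 ≤ t ∧ DSM.discrepancy A a (fδ δ) t = c * δ} t := by
      refine ⟨⟨hτ.le.trans ht, hteq⟩, fun s hs => ?_⟩
      rcases le_total s τ with h | h
      · exact h.trans ht
      · exact (huniq s h hs.2).le
    have e : tδ δ = t := hgreatest.csSup_eq
    rw [e]
    exact ⟨ht, hteq, huniq⟩
  have hlim : Tendsto tδ (𝓝[>] (0 : ℝ)) atTop := by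
    refine tendsto_atTop.2 fun b => ?_
    filter_upwards [hsolve (max b 1) (one_pos.trans_le (le_max_right _ _))] with δ h
    exact (le_max_left _ _).trans h.1
  exact ⟨tδ, hsolve, hlim, DSM.tendsto_solution ha hyc hc.1 hfδ' (hδ.mono hu)
    ((hsolve 1 one_pos).mono fun _ h => h.2.1) hlim⟩
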